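/- Let $a_0,\dots,a_N,b_0,\dots,b_N$ ($N\ge 1$) be mutually independent real random variables on a probability space, each normally distributed with mean $0$ and variance $1$, and let $\eta_j=a_j+ib_j$. Let $f_0,\dots,f_N$ be analytic functions on an open set $U\subseteq\mathbb C$ (for instance $U=\mathbb C$) that are real-valued on $U\cap\mathbb R$, and put $$S_N(z)=\sum_{j=0}^N\eta_jf_j(z),\qquad B_0(z)=\sum_{j=0}^N|f_j(z)|^2,\qquad B_1(z)=\sum_{j=0}^N\overline{f_j(z)}\,f_j'(z),\qquad B_2(z)=\sum_{j=0}^N|f_j'(z)|^2 .$$ Let $D=\{z\in U: B_0(z)\neq 0\}$ and let $K=K_1+iK_2\in\mathbb C$. For compact $\Phi\subset D$ let $\nu_K(\Phi)$ be the number of (distinct) points $z\in\Phi$ with $S_N(z)=K$. A function $h: D\to\mathbb R$ is called an expected density of the zeros of $S_N(z)=K$ if, for every compact $\Phi\subset D$, $\nu_K(\Phi)$ is a random variable with finite expectation, $h$ is integrable on $\Phi$, and $$\mathbb E\,\nu_K(\Phi)=\int_\Phi h(x+iy)\,dx\,dy .$$ Then the function $$h_K(z)=\frac{e^{-(K_1^2+K_2^2)/(2B_0(z))}}{\pi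 B_0(z)}\left\{B_2(z)-\frac{|B_1(z)|^2}{B_0(z)}\left(1-\frac{K_1^2+K_2^2}{2B_0(z)}\right)\right\}$$ is an expected density of the zeros of $S_N(z)=K$. It is the only one: every expected density equals $h_K$ almost everywhere on $D$, and every continuous expected density equals $h_K$ everywhere on $D$. -/

import Mathlib

open MeasureTheory ProbabilityTheory Set

noncomputable section

namespace RandomSum

/-- The random sum `S_N(z) = ∑_{j=0}^N η_j f_j(z)` with `η_j = a_j + i b_j`, at the outcome `ω`. -/
def randomSum {Ω : Type*} {N : ℕ} (a b : Fin (N + 1) → Ω → ℝ) (f : Fin (N + 1) → ℂ → ℂ)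
    (ω : Ω) (z : ℂ) : ℂ :=
  ∑ j, ((a j ω : ℂ) + Complex.I * (b j ω : ℂ)) * f j z

/-- `B_{0,N}(z) = ∑ |f_j(z)|²`. -/
def B0 {N : ℕ} (f : Fin (N + 1) → ℂ → ℂ) (z : ℂ) : ℝ :=
  ∑ j, ‖f j z‖ ^ 2

/-- `B_{1,N}(z) = ∑ conj(f_j(z)) f_j'(z)`. -/
def B1 {N : ℕ} (f : Fin (N + 1) → ℂ → ℂ) (z : ℂ) : ℂ :=
  ∑ j, (starRingEnd ℂ) (f j z) * deriv (f j) z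

/-- `B_{2,N}(z) = ∑ |f_j'(z)|²`. -/
def B2 {N : ℕ} (f : Fin (N + 1) → ℂ → ℂ) (z : ℂ) : ℝ :=
  ∑ j, ‖deriv (f j) z‖ ^ 2

/-- The explicit density, with `K = K₁ + i K₂`. -/
def zeroDensity {N : ℕ} (f : Fin (N + 1) → ℂ → ℂ) (K : ℂ) (z : ℂ) : ℝ :=
  Real.exp (-(K.re ^ 2 + K.im ^ 2) / (2 * B0 f z)) / (Real.pi * B0 f z) *
    (B2 f z - ‖B1 f z‖ ^ 2 / B0 f z * (1 - (K.re ^ 2 + K.im ^ 2) / (2 * B0 f z)))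

/-- The number of points `z ∈ Φ` with `s z = K` (possibly infinite). -/
def zeroCount (s : ℂ → ℂ) (K : ℂ) (Φ : Set ℂ) : ℕ∞ :=
  {z ∈ Φ | s z = K}.encard

/-- `h` is an expected density on `D` of the solutions of `S z = K` for the random function `S`:
for every compact `Φ ⊆ D` the number of solutions in `Φ` is a random variable with finite
expectation, `h` is integrable on `Φ`, and the expectation is `∫_Φ h` (planar Lebesgue measure). -/
def IsExpectedZeroDensity {Ω : Type*} [MeasurableSpace Ω] (P : Measure Ω) (S : Ω → ℂ → ℂ)
    (K : ℂ) (D : Set ℂ) (h : ℂ → ℝ) : Prop :=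
  ∀ Φ : Set ℂ, IsCompact Φ → Φ ⊆ D →
    AEMeasurable (fun ω => (zeroCount (S ω) K Φ : ENNReal)) P ∧
    ∫⁻ ω, (zeroCount (S ω) K Φ : ENNReal) ∂P ≠ ⊤ ∧
    IntegrableOn h Φ volume ∧
    (∫⁻ ω, (zeroCount (S ω) K Φ : ENNReal) ∂P).toReal = ∫ z in Φ, h z

end RandomSum

end

/-!
The theorem is a Kac-Rice formula, proved by solving for one coefficient.

Near a point of `D` some `f j` does not vanish. There `S(z) = K` means `η j = G(z)`, where
`G = (K - ∑_{k ≠ j} η k f k) / f j` is analytic and does not involve `η j`. Conditionally on the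
other coefficients, the expected number of solutions in a set `A` is therefore the integral over
`w ∈ ℂ` of the number of `z ∈ A` with `G(z) = w`, weighted by the standard complex Gaussian
density. By the area formula `lintegral_encard_fiber_mul` this equals the integral over `A` of
`|G'|²` times the density at `G(z)`. The area formula counts distinct points, so multiple or
non-isolated solutions need no separate argument.

After Tonelli, the expectation over the remaining coefficients is a Gaussian integral for each
fixed `z`. Its integrand has the form `kacRiceKernel`: a Gaussian density in one linear form times
a conditional second moment of another. This form is preserved when one more independent
coefficient is integrated out, by completing the square
(`lintegral_kacRiceKernel_sub_mul_add_mul`), and each integration updates the three parameters by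
the corresponding summands of `B₀`, `B₁` and `B₂`. Induction on the number of coefficients gives
the explicit density (`lintegral_zeroCount_of_isSigmaCompact`).

The number of solutions is a measurable function of the coefficients, since having at least `k`
solutions in a compact set that are `1 / (n + 1)`-separated is a closed condition
(`measurable_zeroCount_of_isCompact`).

For uniqueness, two densities have the same integral over every compact subset of the open set
`D`, hence agree almost everywhere, and everywhere if both are continuous.
-/

noncomputable section

namespace RandomSum

/-! ### Counting fibres and the area formula -/

theorem toENNReal_encard_iUnion_of_disjoint {α ι : Type*} [Countable ι] {s : ι → Set α}
    (hs : Pairwise (Function.onFun Disjoint s)) :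
    ((⋃ i, s i).encard : ENNReal) = ∑' i, ((s i).encard : ENNReal) := by
  let _ : MeasurableSpace α := ⊤
  have h : ∀ t : Set α, (t.encard : ENNReal) = Measure.count t := fun t =>
    (Measure.count_apply (MeasurableSpace.measurableSet_top (s := t))).symm
  simp only [h]
  exact measure_iUnion hs fun i => MeasurableSpace.measurableSet_top

theorem toENNReal_encard_iUnion_of_monotone {α : Type*} {s : ℕ → Set α} (hs : Monotone s) :
    ((⋃ i, s i).encard : ENNReal) = ⨆ i, ((s i).encard : ENNReal) := by
  let _ : MeasurableSpace α := ⊤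
  have h : ∀ t : Set α, (t.encard : ENNReal) = Measure.count t := fun t =>
    (Measure.count_apply (MeasurableSpace.measurableSet_top (s := t))).symm
  simp only [h]
  exact hs.measure_iUnion

theorem toENNReal_encard_fiber_of_injOn {α β : Type*} {G : α → β} {s : Set α} (hG : InjOn G s)
    (w : β) : ({z ∈ s | G z = w}.encard : ENNReal) = (G '' s).indicator 1 w := by
  by_cases hw : w ∈ G '' s
  · obtain ⟨z, hz, rfl⟩ := hw
    have : {x ∈ s | G x = G z} = {z} := by
      ext x
      exact ⟨fun h => hG h.1 hz h.2, by rintro rfl; exact ⟨hz, rfl⟩⟩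
    simp [this, mem_image_of_mem G hz]
  · have : {x ∈ s | G x = w} = ∅ := by
      ext x
      simp only [mem_ofPred_eq, mem_empty_iff_false, iff_false]
      exact fun h => hw ⟨x, h⟩
    simp [this, hw]

/-- The real Jacobian of multiplication by `c` on the plane. -/
theorem det_toSpanSingleton_restrictScalars (c : ℂ) :
    ((ContinuousLinearMap.toSpanSingleton ℂ c).restrictScalars ℝ).det = ‖c‖ ^ 2 := by
  rw [← Complex.normSq_eq_norm_sq, ← Algebra.norm_complex_apply, Algebra.norm_apply]
  unfold ContinuousLinearMap.det
  congr 1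
  ext z
  simp [mul_comm]

theorem exists_nhds_injOn_of_deriv_ne_zero {G : ℂ → ℂ} {z : ℂ} (hG : AnalyticAt ℂ G z)
    (hz : deriv G z ≠ 0) : ∃ V ∈ nhds z, InjOn G V := by
  have h := hG.hasStrictDerivAt.hasStrictFDerivAt_equiv hz
  exact ⟨_, (h.toOpenPartialHomeomorph G).open_source.mem_nhds h.mem_toOpenPartialHomeomorph_source,
    (h.toOpenPartialHomeomorph G).injOn⟩

/-- Area formula with multiplicity for an analytic function. No isolatedness of the fibres is
needed: critical values form a null set, and off the critical points `G` is locally injective, so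
the change of variables formula applies on each piece of a countable partition. -/
theorem lintegral_encard_fiber_mul {G : ℂ → ℂ} {A : Set ℂ} (hG : AnalyticOnNhd ℂ G A)
    (hA : MeasurableSet A) {p : ℂ → ENNReal} (hp : Measurable p) :
    ∫⁻ w, ({z ∈ A | G z = w}.encard : ENNReal) * p w =
      ∫⁻ z in A, ENNReal.ofReal (‖deriv G z‖ ^ 2) * p (G z) := by
  classical
  let G' : ℂ → ℂ →L[ℝ] ℂ := fun z =>
    (ContinuousLinearMap.toSpanSingleton ℂ (deriv G z)).restrictScalars ℝ
  have hder : ∀ z ∈ A, HasFDerivAt G (G' z) z := fun z hz =>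
    (hG z hz).differentiableAt.hasDerivAt.hasFDerivAt.restrictScalars ℝ
  have hdet : ∀ z, (G' z).det = ‖deriv G z‖ ^ 2 := fun z => det_toSpanSingleton_restrictScalars _
  have hcrit : MeasurableSet {z | deriv G z = 0} :=
    measurable_deriv G (measurableSet_singleton 0)
  set C : Set ℂ := A ∩ {z | deriv G z = 0} with hC
  set R : Set ℂ := A \ {z | deriv G z = 0} with hR
  have hCm : MeasurableSet C := hA.inter hcrit
  have hRm : MeasurableSet R := hA.diff hcrit
  have hnull : volume (G '' C) = 0 :=
    addHaar_image_eq_zero_of_det_fderivWithin_eq_zero volume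
      (fun z hz => (hder z hz.1).hasFDerivWithinAt) (fun z hz => by
        have : deriv G z = 0 := hz.2
        rw [hdet, this]; simp)
  have hV : ∀ z ∈ R, ∃ V, IsOpen V ∧ z ∈ V ∧ InjOn G V := fun z hz => by
    obtain ⟨V, hV, hi⟩ := exists_nhds_injOn_of_deriv_ne_zero (hG z hz.1) hz.2
    obtain ⟨W, hWV, hW, hzW⟩ := mem_nhds_iff.1 hV
    exact ⟨W, hW, hzW, hi.mono hWV⟩
  choose! V hVo hzV hVi using hV
  obtain ⟨t, htR, htc, ht⟩ := TopologicalSpace.countable_cover_nhdsWithin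
    (f := V) (s := R) fun z hz => mem_nhdsWithin_of_mem_nhds ((hVo z hz).mem_nhds (hzV z hz))
  -- A countable disjoint family of measurable sets covering `R`, on each of which `G` is injective.
  obtain ⟨E, hEm, hEd, hEU, hEi⟩ : ∃ E : ℕ → Set ℂ, (∀ n, MeasurableSet (E n)) ∧
      Pairwise (Function.onFun Disjoint E) ∧ (⋃ n, E n) = R ∧ ∀ n, InjOn G (E n) := by
    rcases t.eq_empty_or_nonempty with rfl | hne
    · refine ⟨fun _ => ∅, fun _ => .empty, fun i j _ => disjoint_bot_left, ?_, fun n => by simp⟩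
      have : R = ∅ := by simpa using ht
      simp [this]
    · obtain ⟨e, he⟩ := htc.exists_eq_range hne
      have heR : ∀ n, e n ∈ R := fun n => htR (he ▸ mem_range_self n)
      refine ⟨fun n => R ∩ disjointed (fun n => V (e n)) n, fun n => hRm.inter
        (MeasurableSet.disjointed (fun n => (hVo _ (heR n)).measurableSet) n), ?_, ?_, ?_⟩
      · intro i j hij
        exact (disjoint_disjointed (fun n => V (e n)) hij).mono inter_subset_right
          inter_subset_right
      · rw [← inter_iUnion, iUnion_disjointed, inter_eq_left]
        intro z hz
        have := ht hz
        rw [he] at this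
        simpa using this
      · exact fun n => (hVi _ (heR n)).mono
          (inter_subset_right.trans (disjointed_subset _ n))
  have hER : ∀ n, E n ⊆ R := fun n => hEU ▸ subset_iUnion E n
  have hderE : ∀ n, ∀ z ∈ E n, HasFDerivWithinAt G (G' z) (E n) z := fun n z hz =>
    (hder z (hER n hz).1).hasFDerivWithinAt
  have himg : ∀ n, MeasurableSet (G '' E n) := fun n =>
    measurable_image_of_fderivWithin (hEm n) (hderE n) (hEi n)
  have hcount : ∀ᵐ w, ({z ∈ A | G z = w}.encard : ENNReal) * p w =
      ∑' n, (G '' E n).indicator p w := by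
    filter_upwards [compl_mem_ae_iff.2 hnull] with w hw
    have hset : {z ∈ A | G z = w} = ⋃ n, {z ∈ E n | G z = w} := by
      ext z
      simp only [mem_ofPred_eq, mem_iUnion]
      constructor
      · rintro ⟨hz, hzw⟩
        have hzR : z ∈ R := ⟨hz, fun h => hw ⟨z, ⟨hz, h⟩, hzw⟩⟩
        rw [← hEU] at hzR
        obtain ⟨n, hn⟩ := mem_iUnion.1 hzR
        exact ⟨n, hn, hzw⟩
      · rintro ⟨n, hn, hzw⟩
        exact ⟨(hER n hn).1, hzw⟩
    rw [hset, toENNReal_encard_iUnion_of_disjoint (fun i j hij =>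
      (hEd hij).mono (sep_subset _ _) (sep_subset _ _)), ← ENNReal.tsum_mul_right]
    refine tsum_congr fun n => ?_
    rw [toENNReal_encard_fiber_of_injOn (hEi n)]
    by_cases h : w ∈ G '' E n <;> simp [h]
  rw [lintegral_congr_ae hcount, lintegral_tsum fun n => (hp.indicator (himg n)).aemeasurable]
  have hsplit : ∫⁻ z in A, ENNReal.ofReal (‖deriv G z‖ ^ 2) * p (G z) =
      ∫⁻ z in R, ENNReal.ofReal (‖deriv G z‖ ^ 2) * p (G z) := by
    rw [← lintegral_inter_add_sdiff _ A hcrit, ← hC, ← hR,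
      setLIntegral_congr_fun hCm (g := fun _ => 0), lintegral_zero, zero_add]
    intro z hz
    have : deriv G z = 0 := hz.2
    simp [this]
  rw [hsplit, ← hEU, lintegral_iUnion hEm hEd]
  refine tsum_congr fun n => ?_
  rw [lintegral_indicator (himg n),
    lintegral_image_eq_lintegral_abs_det_fderiv_mul volume (hEm n) (hderE n) (hEi n)]
  refine lintegral_congr fun z => ?_
  rw [hdet, abs_of_nonneg (by positivity)]

/-! ### Complex Gaussian integrals -/

/-- The law of `a + i b` for independent standard real Gaussian variables `a` and `b`; its total
variance is `2`, not `1`. -/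
def complexGaussian : Measure ℂ :=
  ((gaussianReal 0 1).prod (gaussianReal 0 1)).map
    fun p : ℝ × ℝ => (p.1 : ℂ) + Complex.I * (p.2 : ℂ)

theorem measurable_add_I_mul : Measurable fun p : ℝ × ℝ => (p.1 : ℂ) + Complex.I * (p.2 : ℂ) := by
  fun_prop

instance isProbabilityMeasure_complexGaussian : IsProbabilityMeasure complexGaussian :=
  Measure.isProbabilityMeasure_map measurable_add_I_mul.aemeasurable

theorem measurePreserving_complexGaussian :
    MeasurePreserving (fun p : ℝ × ℝ => (p.1 : ℂ) + Complex.I * (p.2 : ℂ))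
      ((gaussianReal 0 1).prod (gaussianReal 0 1)) complexGaussian :=
  ⟨measurable_add_I_mul, rfl⟩

theorem lintegral_complexGaussian {g : ℂ → ENNReal} (hg : AEMeasurable g) :
    ∫⁻ z, g z ∂complexGaussian =
      ∫⁻ z, g z * ENNReal.ofReal (Real.exp (-‖z‖ ^ 2 / 2) / (2 * Real.pi)) := by
  have hd : complexGaussian =
      volume.withDensity fun z => ENNReal.ofReal (Real.exp (-‖z‖ ^ 2 / 2) / (2 * Real.pi)) := by
    have hpres := Complex.volume_preserving_equiv_real_prod.symm
    refine Measure.ext fun s hs => ?_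
    rw [complexGaussian, Measure.map_apply measurable_add_I_mul hs,
      gaussianReal_of_var_ne_zero 0 one_ne_zero,
      prod_withDensity (measurable_gaussianPDF _ _) (measurable_gaussianPDF _ _),
      withDensity_apply _ (measurable_add_I_mul hs), withDensity_apply _ hs, ← hpres.map_eq,
      setLIntegral_map hs (by fun_prop) hpres.measurable, Measure.volume_eq_prod]
    have hfun : (fun p : ℝ × ℝ => (p.1 : ℂ) + Complex.I * (p.2 : ℂ)) =
        Complex.measurableEquivRealProd.symm := by
      ext p
      rw [Complex.measurableEquivRealProd_symm_apply, Complex.mk_eq_add_mul_I, mul_comm]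
    rw [← hfun]
    refine lintegral_congr fun p => ?_
    rw [gaussianPDF, gaussianPDF, ← ENNReal.ofReal_mul (gaussianPDFReal_nonneg _ _ _)]
    congr 1
    have hn : ‖(p.1 : ℂ) + Complex.I * (p.2 : ℂ)‖ ^ 2 = p.1 ^ 2 + p.2 ^ 2 := by
      rw [← Complex.normSq_eq_norm_sq, Complex.normSq_apply]; simp; ring
    rw [hn, gaussianPDFReal, gaussianPDFReal, mul_mul_mul_comm, ← Real.exp_add, ← mul_inv,
      Real.mul_self_sqrt (by positivity)]
    simp only [NNReal.coe_one, mul_one, sub_zero]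
    rw [show -p.1 ^ 2 / 2 + -p.2 ^ 2 / 2 = -(p.1 ^ 2 + p.2 ^ 2) / 2 by ring]
    ring
  rw [hd, lintegral_withDensity_eq_lintegral_mul₀ (by fun_prop) hg]
  simp only [Pi.mul_apply, mul_comm]

theorem map_re_complexGaussian : complexGaussian.map Complex.re = gaussianReal 0 1 := by
  rw [complexGaussian, Measure.map_map Complex.measurable_re measurable_add_I_mul]
  have : Complex.re ∘ (fun p : ℝ × ℝ => (p.1 : ℂ) + Complex.I * (p.2 : ℂ)) = Prod.fst := by
    ext p; simp
  rw [this, ← Measure.fst, Measure.fst_prod]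

theorem map_im_complexGaussian : complexGaussian.map Complex.im = gaussianReal 0 1 := by
  rw [complexGaussian, Measure.map_map Complex.measurable_im measurable_add_I_mul]
  have : Complex.im ∘ (fun p : ℝ × ℝ => (p.1 : ℂ) + Complex.I * (p.2 : ℂ)) = Prod.snd := by
    ext p; simp
  rw [this, ← Measure.snd, Measure.snd_prod]

theorem integrable_sq_gaussianReal : Integrable (fun x => x ^ 2) (gaussianReal 0 1) :=
  (memLp_id_gaussianReal 2).integrable_sq

theorem integral_sq_gaussianReal : ∫ x, x ^ 2 ∂gaussianReal 0 1 = 1 := by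
  have h := variance_fun_id_gaussianReal (μ := 0) (v := 1)
  rw [variance_of_integral_eq_zero (by fun_prop) (by simp)] at h
  simpa using h

theorem integrable_id_gaussianReal : Integrable (fun x => x) (gaussianReal 0 1) :=
  memLp_one_iff_integrable.1 (memLp_id_gaussianReal 1)

/-- The second moment of an affine function of a complex Gaussian variable. -/
theorem lintegral_norm_add_mul_sq_complexGaussian (A C : ℂ) {c : ℝ} (hc : 0 ≤ c) :
    ∫⁻ z, ENNReal.ofReal (‖A + C * z‖ ^ 2 + c) ∂complexGaussian =
      ENNReal.ofReal (‖A‖ ^ 2 + 2 * ‖C‖ ^ 2 + c) := by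
  have re1 : Integrable Complex.re complexGaussian :=
    (map_re_complexGaussian ▸ integrable_id_gaussianReal :
      Integrable (fun x => x) (complexGaussian.map Complex.re)).comp_measurable
      Complex.measurable_re
  have im1 : Integrable Complex.im complexGaussian :=
    (map_im_complexGaussian ▸ integrable_id_gaussianReal :
      Integrable (fun x => x) (complexGaussian.map Complex.im)).comp_measurable
      Complex.measurable_im
  have re2 : Integrable (fun z : ℂ => z.re ^ 2) complexGaussian :=
    (map_re_complexGaussian ▸ integrable_sq_gaussianReal :
      Integrable (fun x => x ^ 2) (complexGaussian.map Complex.re)).comp_measurable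
      Complex.measurable_re
  have im2 : Integrable (fun z : ℂ => z.im ^ 2) complexGaussian :=
    (map_im_complexGaussian ▸ integrable_sq_gaussianReal :
      Integrable (fun x => x ^ 2) (complexGaussian.map Complex.im)).comp_measurable
      Complex.measurable_im
  have ere1 : ∫ z, z.re ∂complexGaussian = 0 := by
    rw [← integral_map (φ := Complex.re) (f := fun x => x) (by fun_prop) (by fun_prop),
      map_re_complexGaussian, integral_id_gaussianReal]
  have eim1 : ∫ z, z.im ∂complexGaussian = 0 := by
    rw [← integral_map (φ := Complex.im) (f := fun x => x) (by fun_prop) (by fun_prop),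
      map_im_complexGaussian, integral_id_gaussianReal]
  have ere2 : ∫ z, z.re ^ 2 ∂complexGaussian = 1 := by
    rw [← integral_map (φ := Complex.re) (f := fun x => x ^ 2) (by fun_prop) (by fun_prop),
      map_re_complexGaussian, integral_sq_gaussianReal]
  have eim2 : ∫ z, z.im ^ 2 ∂complexGaussian = 1 := by
    rw [← integral_map (φ := Complex.im) (f := fun x => x ^ 2) (by fun_prop) (by fun_prop),
      map_im_complexGaussian, integral_sq_gaussianReal]
  have hexp : ∀ z : ℂ, ‖A + C * z‖ ^ 2 + c =
      (‖A‖ ^ 2 + c) + 2 * (A.re * C.re + A.im * C.im) * z.re +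
        2 * (A.im * C.re - A.re * C.im) * z.im + ‖C‖ ^ 2 * z.re ^ 2 + ‖C‖ ^ 2 * z.im ^ 2 := by
    intro z
    simp only [← Complex.normSq_eq_norm_sq, Complex.normSq_apply, Complex.add_re, Complex.add_im,
      Complex.mul_re, Complex.mul_im]
    ring
  have i0 : Integrable (fun _ : ℂ => ‖A‖ ^ 2 + c) complexGaussian := integrable_const _
  have i1 := re1.const_mul (2 * (A.re * C.re + A.im * C.im))
  have i2 := im1.const_mul (2 * (A.im * C.re - A.re * C.im))
  have i3 := re2.const_mul (‖C‖ ^ 2)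
  have i4 := im2.const_mul (‖C‖ ^ 2)
  have hint : Integrable (fun z => ‖A + C * z‖ ^ 2 + c) complexGaussian := by
    simp only [hexp]
    exact (((i0.add i1).add i2).add i3).add i4
  rw [← ofReal_integral_eq_lintegral_ofReal hint (ae_of_all _ fun z => by positivity)]
  simp only [hexp]
  rw [integral_add (by fun_prop) i4, integral_add (by fun_prop) i3,
    integral_add (by fun_prop) i2, integral_add i0 i1]
  simp only [integral_const_mul, ere1, eim1, ere2, eim2]
  congr 1
  simp
  ring

/-- Let `X` be a centred complex Gaussian variable with `E |X|² = 2 B` and `Y` one with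
`E |Y|² = 2 d`, jointly Gaussian, with `E (conj X) Y = 2 β`. This is the density of `X` at `w`
times the conditional expectation of `|y + Y|²` given `X = w`. -/
def kacRiceKernel (B : ℝ) (β : ℂ) (d : ℝ) (w y : ℂ) : ℝ :=
  Real.exp (-‖w‖ ^ 2 / (2 * B)) / (2 * Real.pi * B) *
    (‖y + β / B * w‖ ^ 2 + 2 * (d - ‖β‖ ^ 2 / B))

theorem measurable_kacRiceKernel {α : Type*} [MeasurableSpace α] {B : α → ℝ} {β : α → ℂ}
    {d : α → ℝ} {w y : α → ℂ} (hB : Measurable B) (hβ : Measurable β) (hd : Measurable d)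
    (hw : Measurable w) (hy : Measurable y) :
    Measurable fun x => kacRiceKernel (B x) (β x) (d x) (w x) (y x) := by
  unfold kacRiceKernel
  fun_prop

/-- Completing the square in the integration variable `η = w conj p / B' + s ξ`, where
`B' = B + |p|²` and `s² = B / B'`. -/
theorem exponent_complete_square {B s : ℝ} (hB : 0 < B) (p w ξ : ℂ)
    (hs : s ^ 2 = B / (B + ‖p‖ ^ 2)) :
    -‖w - (((B + ‖p‖ ^ 2)⁻¹ : ℝ) * (w * starRingEnd ℂ p) + s * ξ) * p‖ ^ 2 / (2 * B) +
      -‖((B + ‖p‖ ^ 2)⁻¹ : ℝ) * (w * starRingEnd ℂ p) + s * ξ‖ ^ 2 / 2 =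
      -‖w‖ ^ 2 / (2 * (B + ‖p‖ ^ 2)) + -‖ξ‖ ^ 2 / 2 := by
  have hpos : 0 < B + ‖p‖ ^ 2 := by positivity
  have hp : ‖p‖ ^ 2 = p.re ^ 2 + p.im ^ 2 := by
    rw [← Complex.normSq_eq_norm_sq, Complex.normSq_apply]; ring
  obtain ⟨t, ht⟩ : ∃ t, t = (B + ‖p‖ ^ 2)⁻¹ := ⟨_, rfl⟩
  have hq : (p.re ^ 2 + p.im ^ 2) * t = 1 - s ^ 2 := by
    rw [← hp, hs, ht]; field_simp; ring
  have h1 : ‖w - (t * (w * starRingEnd ℂ p) + s * ξ) * p‖ ^ 2 = s ^ 2 * ‖s * w - p * ξ‖ ^ 2 := by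
    have : w - (t * (w * starRingEnd ℂ p) + s * ξ) * p = s * (s * w - p * ξ) := by
      have hpp : starRingEnd ℂ p * p * t = 1 - s ^ 2 := by
        rw [mul_comm (starRingEnd ℂ p), Complex.mul_conj, Complex.normSq_eq_norm_sq, hp]
        exact_mod_cast hq
      linear_combination (-w) * hpp
    rw [this, norm_mul, mul_pow, Complex.norm_real, Real.norm_eq_abs, sq_abs]
  have h2 : s ^ 2 / (2 * B) = t / 2 := by rw [hs, ht]; field_simp
  rw [← ht, h1, show -‖w‖ ^ 2 / (2 * (B + ‖p‖ ^ 2)) = -‖w‖ ^ 2 * t / 2 by rw [ht]; field_simp,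
    show -(s ^ 2 * ‖s * w - p * ξ‖ ^ 2) / (2 * B) = -‖s * w - p * ξ‖ ^ 2 * (s ^ 2 / (2 * B)) by ring,
    h2]
  simp only [← Complex.normSq_eq_norm_sq, Complex.normSq_apply, Complex.add_re, Complex.add_im,
    Complex.sub_re, Complex.sub_im, Complex.mul_re, Complex.mul_im, Complex.conj_re,
    Complex.conj_im, Complex.ofReal_re, Complex.ofReal_im]
  linear_combination (-(ξ.re ^ 2 + ξ.im ^ 2) / 2 - t * (w.re ^ 2 + w.im ^ 2) / 2) * hq

/-- The conditional variance after adding one more Gaussian summand. -/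
theorem conditional_variance_add {B d : ℝ} (hB : 0 < B) (β p q : ℂ) :
    (d + ‖q‖ ^ 2) - ‖β + starRingEnd ℂ p * q‖ ^ 2 / (B + ‖p‖ ^ 2) =
      (d - ‖β‖ ^ 2 / B) + B / (B + ‖p‖ ^ 2) * ‖q - β / B * p‖ ^ 2 := by
  have hpos : 0 < B + ‖p‖ ^ 2 := by positivity
  have h : ‖q - β / B * p‖ ^ 2 = ‖B * q - β * p‖ ^ 2 / B ^ 2 := by
    rw [show q - β / B * p = (B * q - β * p) / B by
      have : (B : ℂ) ≠ 0 := by exact_mod_cast hB.ne'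
      field_simp, norm_div, div_pow, Complex.norm_real, Real.norm_eq_abs, sq_abs]
  rw [h]
  field_simp
  simp only [← Complex.normSq_eq_norm_sq, Complex.normSq_apply, Complex.add_re, Complex.add_im,
    Complex.sub_re, Complex.sub_im, Complex.mul_re, Complex.mul_im, Complex.conj_re,
    Complex.conj_im, Complex.ofReal_re, Complex.ofReal_im]
  ring

/-- Adding an independent Gaussian summand `η p` to `X` and `η q` to `Y` in `kacRiceKernel`. -/
theorem lintegral_kacRiceKernel_sub_mul_add_mul {B d : ℝ} {β : ℂ} (hB : 0 < B) (hd : ‖β‖ ^ 2 / B ≤ d)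
    (p q w y : ℂ) :
    ∫⁻ η, ENNReal.ofReal (kacRiceKernel B β d (w - η * p) (y + η * q)) ∂complexGaussian =
      ENNReal.ofReal (kacRiceKernel (B + ‖p‖ ^ 2) (β + starRingEnd ℂ p * q) (d + ‖q‖ ^ 2) w y) := by
  have hpos : 0 < B + ‖p‖ ^ 2 := by positivity
  obtain ⟨s, hs0, hs⟩ : ∃ s : ℝ, 0 < s ∧ s ^ 2 = B / (B + ‖p‖ ^ 2) :=
    ⟨√(B / (B + ‖p‖ ^ 2)), by positivity, Real.sq_sqrt (by positivity)⟩
  set u : ℂ := ((B + ‖p‖ ^ 2)⁻¹ : ℝ) * (w * starRingEnd ℂ p) with hu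
  have hmeas : Measurable fun η =>
      ENNReal.ofReal (kacRiceKernel B β d (w - η * p) (y + η * q)) :=
    (measurable_kacRiceKernel (by fun_prop) (by fun_prop) (by fun_prop) (by fun_prop)
      (by fun_prop)).ennreal_ofReal
  -- The substitution `η = u + s ξ` is an instance of the area formula.
  have hsub : ∀ g : ℂ → ENNReal, Measurable g →
      ∫⁻ η, g η = ∫⁻ ξ, ENNReal.ofReal (s ^ 2) * g (u + s * ξ) := by
    intro g hg
    have hG : ∀ ξ, HasDerivAt (fun ξ : ℂ => u + s * ξ) s ξ := fun ξ => by
      simpa using ((hasDerivAt_id ξ).const_mul (s : ℂ)).const_add u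
    have hsC : (s : ℂ) ≠ 0 := by exact_mod_cast hs0.ne'
    have h := lintegral_encard_fiber_mul (G := fun ξ : ℂ => u + s * ξ) (A := univ)
      (fun ξ _ => by fun_prop) MeasurableSet.univ hg
    rw [Measure.restrict_univ] at h
    simp only [(hG _).deriv, Complex.norm_real, Real.norm_eq_abs, sq_abs] at h
    rw [← h]
    refine lintegral_congr fun w => ?_
    rw [toENNReal_encard_fiber_of_injOn (fun a _ b _ hab => by simpa [hsC] using hab),
      indicator_of_mem]
    · simp
    · exact ⟨(w - u) / s, mem_univ _, by field_simp; ring⟩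
  set c : ℝ := 2 * (d - ‖β‖ ^ 2 / B) with hc
  have hc0 : 0 ≤ c := by rw [hc]; linarith
  set A : ℂ := y + (β + starRingEnd ℂ p * q) / ((B + ‖p‖ ^ 2 : ℝ) : ℂ) * w with hA
  set C : ℂ := s * (q - β / B * p) with hC
  have hlin : ∀ ξ : ℂ, y + (u + s * ξ) * q + β / B * (w - (u + s * ξ) * p) = A + C * ξ := by
    intro ξ
    have hBC : (B : ℂ) ≠ 0 := by exact_mod_cast hB.ne'
    have hpp : starRingEnd ℂ p * p = (‖p‖ : ℂ) ^ 2 := by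
      rw [mul_comm, Complex.mul_conj, Complex.normSq_eq_norm_sq]; push_cast; rfl
    have hBC' : ((B : ℂ) + (‖p‖ : ℂ) ^ 2) ≠ 0 := by exact_mod_cast hpos.ne'
    rw [hA, hC, hu]
    push_cast
    field_simp
    linear_combination (-w * β) * hpp
  rw [lintegral_complexGaussian hmeas.aemeasurable, hsub _ (by fun_prop)]
  have hpt : ∀ ξ : ℂ, ENNReal.ofReal (s ^ 2) *
      (ENNReal.ofReal (kacRiceKernel B β d (w - (u + s * ξ) * p) (y + (u + s * ξ) * q)) *
        ENNReal.ofReal (Real.exp (-‖u + s * ξ‖ ^ 2 / 2) / (2 * Real.pi))) =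
      ENNReal.ofReal (Real.exp (-‖w‖ ^ 2 / (2 * (B + ‖p‖ ^ 2))) / (2 * Real.pi * (B + ‖p‖ ^ 2))) *
      (ENNReal.ofReal (‖A + C * ξ‖ ^ 2 + c) *
        ENNReal.ofReal (Real.exp (-‖ξ‖ ^ 2 / 2) / (2 * Real.pi))) := by
    intro ξ
    have hk : 0 ≤ Real.exp (-‖w - (u + s * ξ) * p‖ ^ 2 / (2 * B)) / (2 * Real.pi * B) *
        (‖A + C * ξ‖ ^ 2 + c) := by positivity
    rw [kacRiceKernel, hlin, ← hc, ← ENNReal.ofReal_mul hk,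
      ← ENNReal.ofReal_mul (by positivity), ← ENNReal.ofReal_mul (by positivity),
      ← ENNReal.ofReal_mul (by positivity)]
    congr 1
    have hexp := congrArg Real.exp (exponent_complete_square hB p w ξ hs)
    rw [Real.exp_add, Real.exp_add, ← hu] at hexp
    have hsB : s ^ 2 / B = 1 / (B + ‖p‖ ^ 2) := by rw [hs]; field_simp
    calc _ = (Real.exp (-‖w - (u + s * ξ) * p‖ ^ 2 / (2 * B)) *
          Real.exp (-‖u + s * ξ‖ ^ 2 / 2)) * (s ^ 2 / B) * (‖A + C * ξ‖ ^ 2 + c) /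
          (2 * Real.pi * (2 * Real.pi)) := by field_simp
      _ = _ := by rw [hexp, hsB]; field_simp
  simp only [hpt]
  rw [lintegral_const_mul _ (by fun_prop), ← lintegral_complexGaussian (by fun_prop),
    lintegral_norm_add_mul_sq_complexGaussian A C hc0, ← ENNReal.ofReal_mul (by positivity),
    kacRiceKernel, ← hA, conditional_variance_add hB]
  congr 2
  rw [hC, norm_mul, mul_pow, Complex.norm_real, Real.norm_eq_abs, sq_abs, hs, hc]
  ring

theorem sum_piFinSuccAbove_symm_mul {n : ℕ} (j : Fin (n + 1)) (η : ℂ) (r : Fin n → ℂ)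
    (p : Fin (n + 1) → ℂ) :
    ∑ k, (MeasurableEquiv.piFinSuccAbove (fun _ : Fin (n + 1) => ℂ) j).symm (η, r) k * p k =
      η * p j + ∑ k, r k * p (j.succAbove k) := by
  rw [Fin.sum_univ_succAbove _ j]
  simp [MeasurableEquiv.piFinSuccAbove_symm_apply, Fin.insertNthEquiv]

/-- The kernel is reproduced under adding finitely many independent Gaussian summands. Starting from
the contribution of a single coefficient, this evaluates the conditional expectation in the
Kac-Rice formula. -/
theorem lintegral_kacRiceKernel_pi {n : ℕ} (p q : Fin n → ℂ) {B d : ℝ} {β : ℂ} (hB : 0 < B)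
    (hd : ‖β‖ ^ 2 / B ≤ d) (w y : ℂ) :
    ∫⁻ r, ENNReal.ofReal (kacRiceKernel B β d (w - ∑ k, r k * p k) (y + ∑ k, r k * q k))
        ∂Measure.pi (fun _ : Fin n => complexGaussian) =
      ENNReal.ofReal (kacRiceKernel (B + ∑ k, ‖p k‖ ^ 2) (β + ∑ k, starRingEnd ℂ (p k) * q k)
        (d + ∑ k, ‖q k‖ ^ 2) w y) := by
  induction n generalizing B d β w y with
  | zero => simp
  | succ n ih =>
    have hB' : 0 < B + ‖p 0‖ ^ 2 := by positivity
    have hd' : ‖β + starRingEnd ℂ (p 0) * q 0‖ ^ 2 / (B + ‖p 0‖ ^ 2) ≤ d + ‖q 0‖ ^ 2 := by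
      have := conditional_variance_add (d := d) hB β (p 0) (q 0)
      have h2 : 0 ≤ B / (B + ‖p 0‖ ^ 2) * ‖q 0 - β / B * p 0‖ ^ 2 := by positivity
      linarith
    have hmp := (measurePreserving_piFinSuccAbove (fun _ : Fin (n + 1) => complexGaussian) 0).symm
    have hmeas : Measurable fun r : Fin (n + 1) → ℂ => ENNReal.ofReal
        (kacRiceKernel B β d (w - ∑ k, r k * p k) (y + ∑ k, r k * q k)) :=
      (measurable_kacRiceKernel (by fun_prop) (by fun_prop) (by fun_prop) (by fun_prop)
        (by fun_prop)).ennreal_ofReal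
    have hmeas' := (hmeas.comp hmp.measurable).aemeasurable
      (μ := complexGaussian.prod (Measure.pi fun _ : Fin n => complexGaussian))
    simp only [Function.comp_def] at hmeas'
    rw [← hmp.lintegral_comp hmeas, lintegral_prod_symm _ hmeas']
    have hin : ∀ r : Fin n → ℂ, ∫⁻ η, ENNReal.ofReal (kacRiceKernel B β d
        (w - ∑ k, (MeasurableEquiv.piFinSuccAbove (fun _ : Fin (n + 1) => ℂ) 0).symm (η, r) k * p k)
        (y + ∑ k, (MeasurableEquiv.piFinSuccAbove (fun _ : Fin (n + 1) => ℂ) 0).symm (η, r) k * q k))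
        ∂complexGaussian = ENNReal.ofReal (kacRiceKernel (B + ‖p 0‖ ^ 2)
          (β + starRingEnd ℂ (p 0) * q 0) (d + ‖q 0‖ ^ 2)
          (w - ∑ k, r k * p k.succ) (y + ∑ k, r k * q k.succ)) := by
      intro r
      rw [← lintegral_kacRiceKernel_sub_mul_add_mul hB hd]
      refine lintegral_congr fun η => ?_
      simp only [sum_piFinSuccAbove_symm_mul, Fin.succAbove_zero]
      congr 2 <;> ring
    simp only [hin]
    rw [ih (fun k => p k.succ) (fun k => q k.succ) hB' hd']
    simp only [Fin.sum_univ_succ, add_assoc]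

/-! ### Measurability of the number of solutions -/

theorem isClosed_exists_separated_fiber {X Z : Type*} [TopologicalSpace X] [MetricSpace Z]
    [CompactSpace Z] {F : X → Z → ℂ} (hF : Continuous (Function.uncurry F)) (K : ℂ) (k n : ℕ) :
    IsClosed {x | ∃ v : Fin k → Z, (∀ i j, i ≠ j → 1 / ((n : ℝ) + 1) ≤ dist (v i) (v j)) ∧
      ∀ i, F x (v i) = K} := by
  have hcl : IsClosed {q : (Fin k → Z) × X |
      (∀ i j, i ≠ j → 1 / ((n : ℝ) + 1) ≤ dist (q.1 i) (q.1 j)) ∧ ∀ i, F q.2 (q.1 i) = K} := by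
    simp only [ofPred_and, ofPred_forall]
    refine IsClosed.inter (isClosed_iInter fun i => isClosed_iInter fun j => isClosed_iInter
      fun _ => isClosed_le (by fun_prop) (by fun_prop)) (isClosed_iInter fun i => ?_)
    exact isClosed_eq (hF.comp (f := fun q : (Fin k → Z) × X => (q.2, q.1 i)) (by fun_prop))
      continuous_const
  convert isClosedMap_snd_of_compactSpace _ hcl using 1
  ext x
  simp

/-- The separation `1 / (n + 1)` replaces the open condition of distinctness by closed ones. -/
theorem natCast_le_encard_iff {Z : Type*} [MetricSpace Z] {s : Set Z} {k : ℕ} :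
    (k : ℕ∞) ≤ s.encard ↔ ∃ n : ℕ, ∃ v : Fin k → Z,
      (∀ i j, i ≠ j → 1 / ((n : ℝ) + 1) ≤ dist (v i) (v j)) ∧ ∀ i, v i ∈ s := by
  constructor
  · intro h
    obtain ⟨t, hts, htk⟩ := exists_subset_encard_eq h
    have htf : t.Finite := finite_of_encard_eq_coe htk
    have hc : htf.toFinset.card = k := by
      rw [htf.encard_eq_coe_toFinset_card] at htk
      exact_mod_cast htk
    let e := htf.toFinset.equivFinOfCardEq hc
    let v : Fin k → Z := fun i => (e.symm i : Z)
    have hv : ∀ i j, i ≠ j → 0 < dist (v i) (v j) := fun i j hij =>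
      dist_pos.2 fun h => hij (e.symm.injective (Subtype.ext h))
    have hfin : ∃ n : ℕ, ∀ q : Fin k × Fin k, q.1 ≠ q.2 →
        1 / ((n : ℝ) + 1) ≤ dist (v q.1) (v q.2) := by
      have : ∀ q : Fin k × Fin k, ∀ᶠ n : ℕ in Filter.atTop, q.1 ≠ q.2 →
          1 / ((n : ℝ) + 1) ≤ dist (v q.1) (v q.2) := by
        intro q
        by_cases hq : q.1 = q.2
        · simp [hq]
        · filter_upwards [(tendsto_order.1 tendsto_one_div_add_atTop_nhds_zero_nat).2 _
            (hv _ _ hq)] with n hn _ using hn.le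
      exact (Filter.eventually_all.2 this).exists
    obtain ⟨n, hn⟩ := hfin
    exact ⟨n, v, fun i j hij => hn (i, j) hij, fun i =>
      hts (htf.mem_toFinset.1 (e.symm i).2)⟩
  · rintro ⟨n, v, hv, hvs⟩
    have hinj : Function.Injective v := fun i j hij => by
      by_contra hne
      have h1 := hv i j hne
      rw [hij, dist_self] at h1
      have : (0 : ℝ) < 1 / ((n : ℝ) + 1) := by positivity
      linarith
    calc (k : ℕ∞) = (range v).encard := by
          rw [← image_univ, hinj.encard_image, encard_univ]; simp
      _ ≤ s.encard := encard_le_encard (range_subset_iff.2 hvs)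

/-- The number of solutions in a compact set is measurable in the parameter: the parameters with
at least `k` solutions form a countable union of closed sets. -/
theorem measurable_zeroCount_of_isCompact {X : Type*} [TopologicalSpace X] [MeasurableSpace X]
    [BorelSpace X] {F : X → ℂ → ℂ} {Φ : Set ℂ} (hΦ : IsCompact Φ)
    (hF : ContinuousOn (Function.uncurry F) (univ ×ˢ Φ)) (K : ℂ) :
    Measurable fun x => (zeroCount (F x) K Φ : ENNReal) := by
  have : CompactSpace Φ := isCompact_iff_compactSpace.1 hΦ
  have hG : Continuous (Function.uncurry fun (x : X) (z : Φ) => F x z) :=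
    hF.comp_continuous (f := fun q : X × Φ => (q.1, (q.2 : ℂ))) (by fun_prop) fun q =>
      ⟨mem_univ _, q.2.2⟩
  have hcard : ∀ x, zeroCount (F x) K Φ = {z : Φ | F x z = K}.encard := by
    intro x
    rw [zeroCount, ← Subtype.val_injective.encard_image]
    congr 1
    ext z
    simp [and_comm]
  have hk : ∀ k : ℕ, MeasurableSet {x | (k : ℕ∞) ≤ zeroCount (F x) K Φ} := by
    intro k
    have hset : {x | (k : ℕ∞) ≤ zeroCount (F x) K Φ} = ⋃ n : ℕ, {x | ∃ v : Fin k → Φ,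
        (∀ i j, i ≠ j → 1 / ((n : ℝ) + 1) ≤ dist (v i) (v j)) ∧ ∀ i, F x (v i) = K} := by
      ext x
      rw [mem_ofPred_eq, hcard, natCast_le_encard_iff, mem_iUnion]
      rfl
    rw [hset]
    exact MeasurableSet.iUnion fun n => (isClosed_exists_separated_fiber hG K k n).measurableSet
  have hE : Measurable fun x => zeroCount (F x) K Φ := by
    refine measurable_to_countable' fun c => ?_
    induction c with
    | top =>
      have : (fun x => zeroCount (F x) K Φ) ⁻¹' {⊤} =
          ⋂ k : ℕ, {x | (k : ℕ∞) ≤ zeroCount (F x) K Φ} := by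
        ext x
        simp [ENat.eq_top_iff_forall_ge]
      rw [this]
      exact MeasurableSet.iInter hk
    | coe k =>
      have : (fun x => zeroCount (F x) K Φ) ⁻¹' {(k : ℕ∞)} =
          {x | (k : ℕ∞) ≤ zeroCount (F x) K Φ} \
            {x | ((k + 1 : ℕ) : ℕ∞) ≤ zeroCount (F x) K Φ} := by
        ext x
        simp only [mem_preimage, mem_singleton_iff, mem_sdiff, mem_ofPred_eq, Nat.cast_add,
          Nat.cast_one, not_le, ENat.lt_add_one_iff (ENat.natCast_ne_top k)]
        rw [and_comm, le_antisymm_iff]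
      rw [this]
      exact (hk k).diff (hk (k + 1))
  exact (measurable_of_countable fun n : ℕ∞ => (n : ENNReal)).comp hE

theorem measurable_zeroCount_of_isSigmaCompact {X : Type*} [TopologicalSpace X]
    [MeasurableSpace X] [BorelSpace X] {F : X → ℂ → ℂ} {A : Set ℂ} (hA : IsSigmaCompact A)
    (hF : ContinuousOn (Function.uncurry F) (univ ×ˢ A)) (K : ℂ) :
    Measurable fun x => (zeroCount (F x) K A : ENNReal) := by
  obtain ⟨C, hC, rfl⟩ := hA
  have hsup : ∀ x, (zeroCount (F x) K (⋃ n, C n) : ENNReal) =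
      ⨆ n, (zeroCount (F x) K (accumulate C n) : ENNReal) := by
    intro x
    have hset : {z ∈ ⋃ n, C n | F x z = K} = ⋃ n, {z ∈ accumulate C n | F x z = K} := by
      rw [← iUnion_accumulate]
      ext z
      simp only [mem_iUnion, mem_ofPred_eq, exists_and_right]
    have hmono : Monotone fun n => {z ∈ accumulate C n | F x z = K} := fun i j hij z hz =>
      ⟨monotone_accumulate hij hz.1, hz.2⟩
    simp only [zeroCount]
    rw [hset, toENNReal_encard_iUnion_of_monotone hmono]
  simp only [hsup]
  refine Measurable.iSup fun n => measurable_zeroCount_of_isCompact ?_ (hF.mono ?_) K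
  · exact (finite_Iic n).isCompact_biUnion fun i _ => hC i
  · exact prod_mono_right (accumulate_subset_iUnion n)

theorem measurableSet_of_isSigmaCompact {A : Set ℂ} (hA : IsSigmaCompact A) : MeasurableSet A := by
  obtain ⟨C, hC, rfl⟩ := hA
  exact MeasurableSet.iUnion fun n => (hC n).isClosed.measurableSet

theorem continuousOn_sum_mul {n : ℕ} {f : Fin n → ℂ → ℂ} {A : Set ℂ}
    (hf : ∀ k, ContinuousOn (f k) A) :
    ContinuousOn (Function.uncurry fun (η : Fin n → ℂ) z => ∑ k, η k * f k z) (univ ×ˢ A) :=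
  continuousOn_finsetSum _ fun k _ => ((continuous_apply k).comp continuous_fst).continuousOn.mul
    ((hf k).comp continuousOn_snd fun _ hq => hq.2)

/-! ### The Kac-Rice formula for Gaussian coefficients -/

/-- The Kac-Rice formula on a set where one fixed `f j` has no zero. The coefficient `η j` is
integrated first, through the area formula for `G = (K - ∑_{k ≠ j} η k f k) / f j`, and then the
remaining coefficients, through `lintegral_kacRiceKernel_pi`. The set is `σ`-compact so that the
number of solutions depends measurably on the coefficients. -/
theorem lintegral_zeroCount_of_isSigmaCompact {N : ℕ} {f : Fin (N + 1) → ℂ → ℂ} {A : Set ℂ}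
    (hf : ∀ j, AnalyticOnNhd ℂ (f j) A) (hA : IsSigmaCompact A) (j : Fin (N + 1))
    (hj : ∀ z ∈ A, f j z ≠ 0) (K : ℂ) :
    ∫⁻ η, (zeroCount (fun z => ∑ k, η k * f k z) K A : ENNReal)
        ∂Measure.pi (fun _ : Fin (N + 1) => complexGaussian) =
      ∫⁻ z in A, ENNReal.ofReal (kacRiceKernel (B0 f z) (B1 f z) (B2 f z) K 0) := by
  have hAm : MeasurableSet A := measurableSet_of_isSigmaCompact hA
  have hfc : ∀ k, ContinuousOn (f k) A := fun k z hz => (hf k z hz).continuousAt.continuousWithinAt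
  have hmeas : Measurable fun η : Fin (N + 1) → ℂ =>
      (zeroCount (fun z => ∑ k, η k * f k z) K A : ENNReal) :=
    measurable_zeroCount_of_isSigmaCompact hA (continuousOn_sum_mul hfc) K
  have hmp := (measurePreserving_piFinSuccAbove (fun _ : Fin (N + 1) => complexGaussian) j).symm
  have hmeas' := (hmeas.comp hmp.measurable).aemeasurable
      (μ := complexGaussian.prod (Measure.pi fun _ : Fin N => complexGaussian))
  simp only [Function.comp_def] at hmeas'
  rw [← hmp.lintegral_comp hmeas, lintegral_prod_symm _ hmeas']
  simp only [sum_piFinSuccAbove_symm_mul]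
  set X : (Fin N → ℂ) → ℂ → ℂ := fun r z => ∑ k, r k * f (j.succAbove k) z with hX
  set Y : (Fin N → ℂ) → ℂ → ℂ := fun r z => ∑ k, r k * deriv (f (j.succAbove k)) z with hY
  set G : (Fin N → ℂ) → ℂ → ℂ := fun r z => (K - X r z) / f j z with hG
  have hXd : ∀ r, ∀ z ∈ A, HasDerivAt (X r) (Y r z) z := fun r z hz =>
    HasDerivAt.fun_sum fun k _ => ((hf _ z hz).differentiableAt.hasDerivAt).const_mul (r k)
  have hGa : ∀ r, AnalyticOnNhd ℂ (G r) A := fun r z hz =>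
    (analyticAt_const.sub (Finset.analyticAt_fun_sum _ fun k _ =>
      analyticAt_const.mul (hf _ z hz))).div (hf j z hz) (hj z hz)
  -- Given the coefficients other than `η j`, the equation reads `G r z = η j`.
  have hinner : ∀ r, ∫⁻ η, (zeroCount (fun z => η * f j z + ∑ k, r k * f (j.succAbove k) z) K A :
      ENNReal) ∂complexGaussian = ∫⁻ z in A, ENNReal.ofReal (kacRiceKernel (‖f j z‖ ^ 2)
        (starRingEnd ℂ (f j z) * deriv (f j) z) (‖deriv (f j) z‖ ^ 2) (K - X r z) (Y r z)) := by
    intro r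
    have hcount : ∀ η, zeroCount (fun z => η * f j z + ∑ k, r k * f (j.succAbove k) z) K A =
        {z ∈ A | G r z = η}.encard := by
      intro η
      rw [zeroCount]
      congr 1
      ext z
      refine and_congr_right fun hz => ?_
      rw [hG]
      simp only
      rw [div_eq_iff (hj z hz), sub_eq_iff_eq_add, eq_comm]
    have hmc : Measurable fun η : ℂ => ({z ∈ A | G r z = η}.encard : ENNReal) := by
      have := measurable_zeroCount_of_isSigmaCompact (F := fun (η : ℂ) z =>
        η * f j z + ∑ k, r k * f (j.succAbove k) z) hA ((continuousOn_fst.mul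
          ((hfc j).comp continuousOn_snd fun q hq => hq.2)).add
          (continuousOn_finsetSum _ fun k _ => continuousOn_const.mul
            ((hfc _).comp continuousOn_snd fun q hq => hq.2))) K
      simpa only [hcount] using this
    simp only [hcount]
    rw [lintegral_complexGaussian hmc.aemeasurable,
      lintegral_encard_fiber_mul (hGa r) hAm (by fun_prop)]
    refine setLIntegral_congr_fun hAm fun z hz => ?_
    have hz0 := hj z hz
    have hn : 0 < ‖f j z‖ := norm_pos_iff.2 hz0
    have hd : deriv (G r) z = -((Y r z + deriv (f j) z / f j z * (K - X r z)) / f j z) := by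
      have hGd : HasDerivAt (G r)
          ((-Y r z * f j z - (K - X r z) * deriv (f j) z) / f j z ^ 2) z :=
        ((hXd r z hz).const_sub K).div (hf j z hz).differentiableAt.hasDerivAt hz0
      rw [hGd.deriv]
      field_simp
      ring
    have hβ : starRingEnd ℂ (f j z) * deriv (f j) z / ((‖f j z‖ ^ 2 : ℝ) : ℂ) =
        deriv (f j) z / f j z := by
      rw [← Complex.normSq_eq_norm_sq, ← Complex.mul_conj,
        mul_comm (f j z), mul_div_mul_left _ _ ((map_ne_zero _).2 hz0)]
    have hGz : ‖G r z‖ = ‖K - X r z‖ / ‖f j z‖ := norm_div _ _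
    rw [← ENNReal.ofReal_mul (by positivity), kacRiceKernel, hβ, hd, norm_neg, norm_div,
      hGz, norm_mul, RCLike.norm_conj]
    congr 1
    have h1 : -(‖K - X r z‖ / ‖f j z‖) ^ 2 / 2 = -‖K - X r z‖ ^ 2 / (2 * ‖f j z‖ ^ 2) := by
      field_simp
    -- With the other coefficients fixed, the derivative at a solution carries no further variance.
    have h2 : ‖deriv (f j) z‖ ^ 2 - (‖f j z‖ * ‖deriv (f j) z‖) ^ 2 / ‖f j z‖ ^ 2 = 0 := by
      field_simp
      ring
    rw [h1, h2]
    field_simp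
    ring
  simp only [hinner]
  have hfm : ∀ k, AEMeasurable (f k) (volume.restrict A) := fun k => (hfc k).aemeasurable hAm
  have hfm2 : ∀ k, AEMeasurable (fun q : (Fin N → ℂ) × ℂ => f k q.2)
      ((Measure.pi fun _ : Fin N => complexGaussian).prod (volume.restrict A)) := fun k =>
    (hfm k).comp_snd
  have hdm2 : ∀ k, Measurable (fun q : (Fin N → ℂ) × ℂ => deriv (f k) q.2) := fun k =>
    (measurable_deriv (f k)).comp measurable_snd
  rw [lintegral_lintegral_swap]
  · refine setLIntegral_congr_fun hAm fun z hz => ?_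
    have hn : 0 < ‖f j z‖ := norm_pos_iff.2 (hj z hz)
    simp only [hX, hY]
    have := lintegral_kacRiceKernel_pi (fun k => f (j.succAbove k) z)
      (fun k => deriv (f (j.succAbove k)) z) (B := ‖f j z‖ ^ 2) (d := ‖deriv (f j) z‖ ^ 2)
      (β := starRingEnd ℂ (f j z) * deriv (f j) z) (by positivity) (by
        rw [norm_mul, RCLike.norm_conj, mul_pow, mul_div_cancel_left₀ _ (by positivity)]) K 0
    simp only [zero_add] at this
    rw [this, B0, B1, B2, Fin.sum_univ_succAbove _ j, Fin.sum_univ_succAbove _ j,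
      Fin.sum_univ_succAbove _ j]
  · have hXm : AEMeasurable (fun q : (Fin N → ℂ) × ℂ => X q.1 q.2)
        ((Measure.pi fun _ : Fin N => complexGaussian).prod (volume.restrict A)) := by
      simp only [hX]
      exact Finset.aemeasurable_fun_sum _ fun k _ => (by fun_prop : Measurable
        fun q : (Fin N → ℂ) × ℂ => q.1 k).aemeasurable.mul (hfm2 _)
    have hYm : Measurable (fun q : (Fin N → ℂ) × ℂ => Y q.1 q.2) := by
      simp only [hY]
      exact Finset.measurable_fun_sum _ fun k _ => (by fun_prop : Measurable
        fun q : (Fin N → ℂ) × ℂ => q.1 k).mul (hdm2 _)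
    have hk := measurable_kacRiceKernel (α := ℂ × ℂ × ℂ × ℂ) (B := fun q => ‖q.1‖ ^ 2)
      (β := fun q => starRingEnd ℂ q.1 * q.2.1) (d := fun q => ‖q.2.1‖ ^ 2)
      (w := fun q => K - q.2.2.1) (y := fun q => q.2.2.2) (by fun_prop)
      (by fun_prop) (by fun_prop) (by fun_prop) (by fun_prop)
    exact (hk.comp_aemeasurable ((hfm2 j).prodMk ((hdm2 j).aemeasurable.prodMk
      (hXm.prodMk hYm.aemeasurable)))).ennreal_ofReal

theorem kacRiceKernel_zero_eq_zeroDensity {N : ℕ} {f : Fin (N + 1) → ℂ → ℂ} {z : ℂ}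
    (hz : B0 f z ≠ 0) (K : ℂ) :
    kacRiceKernel (B0 f z) (B1 f z) (B2 f z) K 0 = zeroDensity f K z := by
  have hK : K.re ^ 2 + K.im ^ 2 = ‖K‖ ^ 2 := by
    rw [← Complex.normSq_eq_norm_sq, Complex.normSq_apply]; ring
  rw [kacRiceKernel, zeroDensity, hK, zero_add, norm_mul, norm_div, Complex.norm_real,
    Real.norm_eq_abs, mul_pow, div_pow, sq_abs]
  field_simp
  ring

/-- Nonnegativity is the Cauchy-Schwarz inequality `|B₁|² ≤ B₀ B₂`. -/
theorem zeroDensity_nonneg {N : ℕ} (f : Fin (N + 1) → ℂ → ℂ) (K z : ℂ) :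
    0 ≤ zeroDensity f K z := by
  by_cases hz : B0 f z = 0
  · simp [zeroDensity, hz]
  have hB0 : 0 ≤ B0 f z := Finset.sum_nonneg fun j _ => by positivity
  have hB0' : 0 < B0 f z := lt_of_le_of_ne hB0 (Ne.symm hz)
  have hcs : ‖B1 f z‖ ^ 2 ≤ B0 f z * B2 f z := by
    calc ‖B1 f z‖ ^ 2 ≤ (∑ j, ‖f j z‖ * ‖deriv (f j) z‖) ^ 2 := by
          gcongr
          refine (norm_sum_le _ _).trans_eq ?_
          simp only [norm_mul, RCLike.norm_conj]
      _ ≤ B0 f z * B2 f z := Finset.sum_mul_sq_le_sq_mul_sq _ _ _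
  have h : 0 ≤ B2 f z - ‖B1 f z‖ ^ 2 / B0 f z := by
    rw [sub_nonneg, div_le_iff₀ hB0', mul_comm]
    exact hcs
  rw [← kacRiceKernel_zero_eq_zeroDensity hz, kacRiceKernel]
  positivity

theorem B0_ne_zero_iff {N : ℕ} {f : Fin (N + 1) → ℂ → ℂ} {z : ℂ} :
    B0 f z ≠ 0 ↔ ∃ j, f j z ≠ 0 := by
  rw [B0, Ne, Finset.sum_eq_zero_iff_of_nonneg fun j _ => by positivity]
  simp

/-- A compact set without common zeros of the `f j` splits into finitely many `σ`-compact pieces,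
according to the first `f j` that does not vanish. -/
theorem lintegral_zeroCount_of_isCompact {N : ℕ} {f : Fin (N + 1) → ℂ → ℂ} {Φ : Set ℂ}
    (hf : ∀ j, AnalyticOnNhd ℂ (f j) Φ) (hΦ : IsCompact Φ) (h0 : ∀ z ∈ Φ, B0 f z ≠ 0) (K : ℂ) :
    ∫⁻ η, (zeroCount (fun z => ∑ k, η k * f k z) K Φ : ENNReal)
        ∂Measure.pi (fun _ : Fin (N + 1) => complexGaussian) =
      ∫⁻ z in Φ, ENNReal.ofReal (zeroDensity f K z) := by
  have hfc : ∀ k, ContinuousOn (f k) Φ := fun k z hz => (hf k z hz).continuousAt.continuousWithinAt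
  -- The points of `Φ` at which `j` is the first index with `f j z ≠ 0`.
  set A : Fin (N + 1) → Set ℂ := fun j => {z ∈ Φ | f j z ≠ 0 ∧ ∀ i < j, f i z = 0} with hA
  have hAΦ : ∀ j, A j ⊆ Φ := fun j => sep_subset _ _
  have hAs : ∀ j, IsSigmaCompact (A j) := by
    intro j
    refine ⟨fun n => Φ ∩ {z | 1 / ((n : ℝ) + 1) ≤ ‖f j z‖ ∧ ∀ i < j, f i z = 0}, fun n => ?_, ?_⟩
    · have h1 : IsClosed (Φ ∩ {z | 1 / ((n : ℝ) + 1) ≤ ‖f j z‖}) :=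
        (hfc j).norm.preimage_isClosed_of_isClosed hΦ.isClosed isClosed_Ici
      have h2 : ∀ i, IsClosed (Φ ∩ {z | f i z = 0}) := fun i =>
        (hfc i).preimage_isClosed_of_isClosed hΦ.isClosed isClosed_singleton
      have : Φ ∩ {z | 1 / ((n : ℝ) + 1) ≤ ‖f j z‖ ∧ ∀ i < j, f i z = 0} =
          (Φ ∩ {z | 1 / ((n : ℝ) + 1) ≤ ‖f j z‖}) ∩ (Φ ∩ ⋂ i < j, Φ ∩ {z | f i z = 0}) := by
        ext z
        simp only [mem_inter_iff, mem_ofPred_eq, mem_iInter]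
        constructor
        · rintro ⟨h, h', h''⟩
          exact ⟨⟨h, h'⟩, h, fun i hi => ⟨h, h'' i hi⟩⟩
        · rintro ⟨⟨h, h'⟩, -, h''⟩
          exact ⟨h, h', fun i hi => (h'' i hi).2⟩
      simp only [this]
      exact hΦ.of_isClosed_subset (h1.inter (hΦ.isClosed.inter
        (isClosed_biInter fun i _ => h2 i))) fun z hz => hz.1.1
    · ext z
      simp only [hA, mem_iUnion, mem_inter_iff, mem_ofPred_eq]
      constructor
      · rintro ⟨n, hz, hn, hi⟩
        refine ⟨hz, fun h => ?_, hi⟩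
        rw [h, norm_zero] at hn
        have : (0 : ℝ) < 1 / ((n : ℝ) + 1) := by positivity
        linarith
      · rintro ⟨hz, hn, hi⟩
        obtain ⟨n, hn⟩ := exists_nat_one_div_lt (norm_pos_iff.2 hn)
        exact ⟨n, hz, hn.le, hi⟩
  have hAd : Pairwise (Function.onFun Disjoint A) := by
    intro i j hij
    refine disjoint_left.2 fun z hi hj => ?_
    rcases lt_or_gt_of_ne hij with h | h
    · exact hi.2.1 (hj.2.2 i h)
    · exact hj.2.1 (hi.2.2 j h)
  have hAU : ⋃ j, A j = Φ := by
    refine subset_antisymm (iUnion_subset hAΦ) fun z hz => ?_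
    have hne : ∃ j, f j z ≠ 0 := B0_ne_zero_iff.1 (h0 z hz)
    classical
    refine mem_iUnion.2 ⟨Fin.find _ hne, hz, Fin.find_spec hne, fun i hi => ?_⟩
    exact not_not.1 (Fin.find_min hne hi)
  have hAm : ∀ j, MeasurableSet (A j) := fun j => measurableSet_of_isSigmaCompact (hAs j)
  have hcount : ∀ s : ℂ → ℂ, (zeroCount s K Φ : ENNReal) =
      ∑ j, (zeroCount s K (A j) : ENNReal) := by
    intro s
    have hset : {z ∈ Φ | s z = K} = ⋃ j, {z ∈ A j | s z = K} := by
      rw [← hAU]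
      ext z
      simp
    rw [zeroCount, hset, toENNReal_encard_iUnion_of_disjoint (fun i j hij =>
      (hAd hij).mono (sep_subset _ _) (sep_subset _ _)), tsum_fintype]
    rfl
  simp only [hcount]
  rw [lintegral_finsetSum' _ fun j _ => ?_]
  · conv_rhs => rw [← hAU, lintegral_iUnion hAm hAd, tsum_fintype]
    refine Finset.sum_congr rfl fun j _ => ?_
    rw [lintegral_zeroCount_of_isSigmaCompact (fun k => (hf k).mono (hAΦ j)) (hAs j) j
      (fun z hz => hz.2.1)]
    exact setLIntegral_congr_fun (hAm j) fun z hz => by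
      simp only [kacRiceKernel_zero_eq_zeroDensity (h0 z hz.1)]
  · exact (measurable_zeroCount_of_isSigmaCompact (hAs j) (continuousOn_sum_mul fun k =>
      (hfc k).mono (hAΦ j)) K).aemeasurable

/-! ### The expected density and its uniqueness -/

theorem measurePreserving_pi_complexGaussian (n : ℕ) :
    MeasurePreserving (fun (x : Fin n ⊕ Fin n → ℝ) k =>
        (x (.inl k) : ℂ) + Complex.I * (x (.inr k) : ℂ))
      (Measure.pi fun _ => gaussianReal 0 1) (Measure.pi fun _ => complexGaussian) :=
  ((measurePreserving_pi (fun _ : Fin n => (gaussianReal 0 1).prod (gaussianReal 0 1))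
    (fun _ => complexGaussian) fun _ => measurePreserving_complexGaussian).comp
    (measurePreserving_arrowProdEquivProdArrow ℝ ℝ (Fin n) (fun _ => gaussianReal 0 1)
      fun _ => gaussianReal 0 1).symm).comp
    (measurePreserving_sumPiEquivProdPi fun _ : Fin n ⊕ Fin n => gaussianReal 0 1)

/-- The vector of coefficients `η j = a j + i b j` consists of independent complex Gaussian
variables. -/
theorem map_coefficients_eq_pi {Ω : Type*} [MeasurableSpace Ω] {P : Measure Ω}
    [IsProbabilityMeasure P] {n : ℕ} {a b : Fin n → Ω → ℝ}
    (ha : ∀ j, HasLaw (a j) (gaussianReal 0 1) P)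
    (hb : ∀ j, HasLaw (b j) (gaussianReal 0 1) P) (hab : iIndepFun (Sum.elim a b) P) :
    AEMeasurable (fun ω j => (a j ω : ℂ) + Complex.I * (b j ω : ℂ)) P ∧
      P.map (fun ω j => (a j ω : ℂ) + Complex.I * (b j ω : ℂ)) =
        Measure.pi fun _ => complexGaussian := by
  have hlaw : ∀ i, HasLaw (Sum.elim a b i) (gaussianReal 0 1) P := by
    rintro (i | i)
    · exact ha i
    · exact hb i
  have hm : AEMeasurable (fun ω i => Sum.elim a b i ω) P :=
    aemeasurable_pi_lambda _ fun i => (hlaw i).aemeasurable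
  have h := hab.map_fun_eq_pi_map fun i => (hlaw i).aemeasurable
  simp only [(hlaw _).map_eq] at h
  have hmp := measurePreserving_pi_complexGaussian n
  refine ⟨hmp.measurable.comp_aemeasurable hm, ?_⟩
  rw [← hmp.map_eq, ← h, AEMeasurable.map_map_of_aemeasurable hmp.measurable.aemeasurable hm]
  rfl

theorem continuousOn_zeroDensity {N : ℕ} {f : Fin (N + 1) → ℂ → ℂ} {U : Set ℂ}
    (hf : ∀ j, AnalyticOnNhd ℂ (f j) U) (K : ℂ) :
    ContinuousOn (zeroDensity f K) {z ∈ U | B0 f z ≠ 0} := by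
  have hfc : ∀ j, ContinuousOn (f j) {z ∈ U | B0 f z ≠ 0} := fun j =>
    (hf j).continuousOn.mono (sep_subset _ _)
  have hdc : ∀ j, ContinuousOn (deriv (f j)) {z ∈ U | B0 f z ≠ 0} := fun j =>
    (hf j).deriv.continuousOn.mono (sep_subset _ _)
  have h0 : ContinuousOn (B0 f) {z ∈ U | B0 f z ≠ 0} :=
    continuousOn_finsetSum _ fun j _ => (hfc j).norm.pow 2
  have h1 : ContinuousOn (B1 f) {z ∈ U | B0 f z ≠ 0} :=
    continuousOn_finsetSum _ fun j _ =>
      (Complex.continuous_conj.comp_continuousOn (hfc j)).mul (hdc j)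
  have h2 : ContinuousOn (B2 f) {z ∈ U | B0 f z ≠ 0} :=
    continuousOn_finsetSum _ fun j _ => (hdc j).norm.pow 2
  have hne : ∀ z ∈ {z ∈ U | B0 f z ≠ 0}, B0 f z ≠ 0 := fun z hz => hz.2
  have hne2 : ∀ z ∈ {z ∈ U | B0 f z ≠ 0}, 2 * B0 f z ≠ 0 := fun z hz =>
    mul_ne_zero two_ne_zero hz.2
  have hnepi : ∀ z ∈ {z ∈ U | B0 f z ≠ 0}, Real.pi * B0 f z ≠ 0 := fun z hz =>
    mul_ne_zero Real.pi_ne_zero hz.2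
  have hquot : ∀ c : ℝ, ContinuousOn (fun z => c / (2 * B0 f z)) {z ∈ U | B0 f z ≠ 0} := fun c =>
    continuousOn_const.div (continuousOn_const.mul h0) hne2
  exact ((hquot _).rexp.div (continuousOn_const.mul h0) hnepi).mul
    (h2.sub (((h1.norm.pow 2).div h0 hne).mul (continuousOn_const.sub (hquot _))))

theorem isOpen_B0_ne_zero {N : ℕ} {f : Fin (N + 1) → ℂ → ℂ} {U : Set ℂ} (hU : IsOpen U)
    (hf : ∀ j, AnalyticOnNhd ℂ (f j) U) : IsOpen {z ∈ U | B0 f z ≠ 0} := by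
  have h0 : ContinuousOn (B0 f) U :=
    continuousOn_finsetSum _ fun j _ => (hf j).continuousOn.norm.pow 2
  exact h0.isOpen_inter_preimage hU isOpen_compl_singleton

theorem isExpectedZeroDensity_zeroDensity {Ω : Type*} [MeasurableSpace Ω] {P : Measure Ω}
    [IsProbabilityMeasure P] {N : ℕ} {a b : Fin (N + 1) → Ω → ℝ}
    (ha : ∀ j, HasLaw (a j) (gaussianReal 0 1) P)
    (hb : ∀ j, HasLaw (b j) (gaussianReal 0 1) P) (hab : iIndepFun (Sum.elim a b) P)
    {U : Set ℂ} {f : Fin (N + 1) → ℂ → ℂ} (hf : ∀ j, AnalyticOnNhd ℂ (f j) U) (K : ℂ) :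
    IsExpectedZeroDensity P (randomSum a b f) K {z ∈ U | B0 f z ≠ 0} (zeroDensity f K) := by
  intro Φ hΦ hΦD
  have hfΦ : ∀ j, AnalyticOnNhd ℂ (f j) Φ := fun j z hz => hf j z (hΦD hz).1
  have hmeas : Measurable fun η : Fin (N + 1) → ℂ =>
      (zeroCount (fun z => ∑ k, η k * f k z) K Φ : ENNReal) :=
    measurable_zeroCount_of_isCompact hΦ
      (continuousOn_sum_mul fun k => (hfΦ k).continuousOn) K
  obtain ⟨hη, hlaw⟩ := map_coefficients_eq_pi ha hb hab
  have hint : IntegrableOn (zeroDensity f K) Φ volume :=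
    ((continuousOn_zeroDensity hf K).mono hΦD).integrableOn_compact hΦ
  have hexp : ∫⁻ ω, (zeroCount (randomSum a b f ω) K Φ : ENNReal) ∂P =
      ENNReal.ofReal (∫ z in Φ, zeroDensity f K z) := by
    rw [ofReal_integral_eq_lintegral_ofReal hint (ae_of_all _ (zeroDensity_nonneg f K)),
      ← lintegral_zeroCount_of_isCompact hfΦ hΦ (fun z hz => (hΦD hz).2), ← hlaw,
      lintegral_map' hmeas.aemeasurable hη]
    rfl
  refine ⟨hmeas.comp_aemeasurable hη, ?_, hint, ?_⟩
  · rw [hexp]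
    exact ENNReal.ofReal_ne_top
  · rw [hexp, ENNReal.toReal_ofReal (integral_nonneg (zeroDensity_nonneg f K))]

/-- A function on an open set is determined almost everywhere by its integrals over the compact
subsets. -/
theorem ae_eq_restrict_of_forall_isCompact_setIntegral_eq {D : Set ℂ} (hD : IsOpen D)
    {g h : ℂ → ℝ} (hg : ∀ Φ, IsCompact Φ → Φ ⊆ D → IntegrableOn g Φ volume)
    (hh : ∀ Φ, IsCompact Φ → Φ ⊆ D → IntegrableOn h Φ volume)
    (heq : ∀ Φ, IsCompact Φ → Φ ⊆ D → ∫ z in Φ, g z = ∫ z in Φ, h z) :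
    g =ᵐ[volume.restrict D] h := by
  obtain ⟨C, hC, hCD⟩ : IsSigmaCompact D := by
    have := hD.locallyCompactSpace
    exact isSigmaCompact_iff_sigmaCompactSpace.2 inferInstance
  rw [← hCD]
  refine (ae_restrict_iUnion_iff _ _).2 fun n => ?_
  have hsub : C n ⊆ D := hCD ▸ subset_iUnion C n
  have h0 : (fun z => g z - h z) =ᵐ[volume.restrict (C n)] 0 := by
    refine ae_eq_zero_of_forall_setIntegral_isCompact_eq_zero
      ((hg _ (hC n) hsub).sub (hh _ (hC n) hsub)) fun s hs => ?_
    have hs' : IsCompact (s ∩ C n) := hs.inter (hC n)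
    have hsD : s ∩ C n ⊆ D := inter_subset_right.trans hsub
    rw [Measure.restrict_restrict hs.measurableSet, integral_sub (hg _ hs' hsD) (hh _ hs' hsD),
      heq _ hs' hsD, sub_self]
  filter_upwards [h0] with z hz using sub_eq_zero.1 hz

end RandomSum

end

theorem theorem1 {Ω : Type*} [MeasurableSpace Ω] (P : Measure Ω) [IsProbabilityMeasure P]
    (N : ℕ) (hN : 0 < N)
    (a b : Fin (N + 1) → Ω → ℝ)
    (ha : ∀ j, HasLaw (a j) (gaussianReal 0 1) P)
    (hb : ∀ j, HasLaw (b j) (gaussianReal 0 1) P)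
    (hab : iIndepFun (Sum.elim a b) P)
    (U : Set ℂ) (hU : IsOpen U)
    (f : Fin (N + 1) → ℂ → ℂ)
    (hf : ∀ j, AnalyticOnNhd ℂ (f j) U)
    (hreal : ∀ j, ∀ x : ℝ, (x : ℂ) ∈ U → (f j (x : ℂ)).im = 0)
    (K : ℂ) :
    RandomSum.IsExpectedZeroDensity P (RandomSum.randomSum a b f) K
        {z ∈ U | RandomSum.B0 f z ≠ 0} (RandomSum.zeroDensity f K) ∧
      ∀ h : ℂ → ℝ,
        RandomSum.IsExpectedZeroDensity P (RandomSum.randomSum a b f) K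
            {z ∈ U | RandomSum.B0 f z ≠ 0} h →
          h =ᵐ[volume.restrict {z ∈ U | RandomSum.B0 f z ≠ 0}] RandomSum.zeroDensity f K ∧
          (ContinuousOn h {z ∈ U | RandomSum.B0 f z ≠ 0} →
            EqOn h (RandomSum.zeroDensity f K) {z ∈ U | RandomSum.B0 f z ≠ 0}) := by
  have hmain := RandomSum.isExpectedZeroDensity_zeroDensity ha hb hab hf K
  have hD := RandomSum.isOpen_B0_ne_zero hU hf
  refine ⟨hmain, fun h hh => ?_⟩
  have hae : h =ᵐ[volume.restrict {z ∈ U | RandomSum.B0 f z ≠ 0}] RandomSum.zeroDensity f K :=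
    RandomSum.ae_eq_restrict_of_forall_isCompact_setIntegral_eq hD
      (fun Φ hΦ hs => (hh Φ hΦ hs).2.2.1) (fun Φ hΦ hs => (hmain Φ hΦ hs).2.2.1)
      fun Φ hΦ hs => (hh Φ hΦ hs).2.2.2.symm.trans (hmain Φ hΦ hs).2.2.2
  exact ⟨hae, fun hc => Measure.eqOn_open_of_ae_eq hae hD hc
    (RandomSum.continuousOn_zeroDensity hf K)⟩
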